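/- Let $n$ be a dimension, $p\ge 2$, and let $h\in C^2(\mathbb R^n)$ be nonnegative, positively homogeneous of degree $p$, and such that for some $\lambda,\Lambda>0$ $$\lambda|v|^2\le\langle D^2h(x)v,v\rangle\le\Lambda|v|^2\qquad\text{for all } x\in S^{n-1},\ v\in\mathbb R^n .$$ Let $T:\mathbb R^n\to\mathcal P(\mathbb R^n)$ be an $h$-monotone multivalued map, i.e. $$h(x-\xi)+h(y-\zeta)\le h(x-\zeta)+h(y-\xi)\qquad\text{for all } x,y\in\mathrm{dom}(T)=\{x: T(x)\ne\emptyset\},\ \xi\in T(x),\ \zeta\in T(y).$$ Let $x_0\in\mathbb R^n$ and $\varepsilon>0$, and suppose that $T\in L^{p-1}(B_\varepsilon(x_0))$, meaning that there is $f\in L^{p-1}(B_\varepsilon(x_0);\mathbb R^n)$ with $f(x)\in T(x)$ for a.e. $x\in B_\varepsilon(x_0)$. Suppose there exist a matrix $A\in\mathbb R^{n\times n}$ and a vector $b\in\mathbb R^n$ such that $$\left(\frac1{|B_R(x_0)|}\int_{B_R(x_0)}|f(x)-Ax-b|^{p-1}\,dx\right)^{1/(p-1)}=o(R)\qquad\text{as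 } R\to0^+ ,$$ that is, $T\in t^{1,p-1}(x_0)$. Then $T$ is differentiable in the ordinary sense at $x_0$, with derivative $A$: $$\sup\{|\xi-Ax-b| : x\in B_R(x_0),\ \xi\in T(x)\}=o(R)\qquad\text{as } R\to0^+ ,$$ and, if $x_0\in\mathrm{dom}(T)$, then $T(x_0)$ is a single point $\{y_0\}$ and $|\xi-y_0-A(x-x_0)|=o(|x-x_0|)$ as $x\to x_0$, uniformly in $\xi\in T(x)$. -/

import Mathlib

open Filter Topology MeasureTheory Metric Asymptotics

namespace HMonotone

/-- `ℝⁿ` with its Euclidean norm. -/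
abbrev E (n : ℕ) : Type := EuclideanSpace ℝ (Fin n)

/-- The admissible costs: `h ∈ C²(ℝⁿ)` is nonnegative, positively homogeneous of degree `p`, and
`λ|v|² ≤ ⟨D²h(x)v, v⟩ ≤ Λ|v|²` for all unit vectors `x` and all `v`, for some `λ, Λ > 0`. -/
structure IsCost {n : ℕ} (p : ℝ) (h : E n → ℝ) : Prop where
  contDiff : ContDiff ℝ 2 h
  nonneg : ∀ x, 0 ≤ h x
  homogeneous : ∀ (t : ℝ) (x : E n), 0 < t → h (t • x) = t ^ p * h x
  elliptic : ∃ l L : ℝ, 0 < l ∧ 0 < L ∧ ∀ x v : E n, ‖x‖ = 1 →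
    l * ‖v‖ ^ 2 ≤ fderiv ℝ (fderiv ℝ h) x v v ∧ fderiv ℝ (fderiv ℝ h) x v v ≤ L * ‖v‖ ^ 2

/-- The domain `{x : T x ≠ ∅}` of a multivalued map. -/
def dom {n : ℕ} (T : E n → Set (E n)) : Set (E n) := {x | (T x).Nonempty}

/-- The multivalued map `T` is `h`-monotone (points outside `dom T` impose no condition). -/
def IsHMonotone {n : ℕ} (h : E n → ℝ) (T : E n → Set (E n)) : Prop :=
  ∀ x y ξ ζ : E n, ξ ∈ T x → ζ ∈ T y → h (x - ξ) + h (y - ζ) ≤ h (x - ζ) + h (y - ξ)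

/-- `f` represents the multivalued map `T` on `Ω` as an element of `L^q(Ω)`: it is an
`L^q(Ω)` function with `f x ∈ T x` for almost every `x ∈ Ω`. (No single-valuedness of `T` is
assumed.) -/
def RepresentsInLp {n : ℕ} (T : E n → Set (E n)) (f : E n → E n) (q : ℝ) (Ω : Set (E n)) : Prop :=
  MemLp f (ENNReal.ofReal q) (volume.restrict Ω) ∧ ∀ᵐ x ∂(volume.restrict Ω), f x ∈ T x

/-- The affine map `x ↦ Ax + b`. -/
noncomputable def affine {n : ℕ} (A : Matrix (Fin n) (Fin n) ℝ) (b x : E n) : E n :=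
  Matrix.toEuclideanCLM (𝕜 := ℝ) A x + b

/-- `(⨍_{B_R(x₀)} |f(x) - Ax - b|^q dx)^{1/q} = o(R)` as `R → 0⁺`. -/
def ApproxInMean {n : ℕ} (f : E n → E n) (q : ℝ) (x₀ : E n)
    (A : Matrix (Fin n) (Fin n) ℝ) (b : E n) : Prop :=
  (fun R : ℝ => (⨍ x in ball x₀ R, ‖f x - affine A b x‖ ^ q) ^ (1 / q)) =o[𝓝[>] 0]
    (fun R : ℝ => R)

/-- `sup {|ξ - Ax - b| : x ∈ B_R(x₀), ξ ∈ T x} = o(R)` as `R → 0⁺`. -/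
def ApproxInSup {n : ℕ} (T : E n → Set (E n)) (x₀ : E n)
    (A : Matrix (Fin n) (Fin n) ℝ) (b : E n) : Prop :=
  ∀ η : ℝ, 0 < η → ∀ᶠ R in 𝓝[>] (0 : ℝ), ∀ x ∈ ball x₀ R, ∀ ξ ∈ T x,
    ‖ξ - affine A b x‖ ≤ η * R

/-- Ordinary differentiability of a multivalued map at `x₀`, with derivative `A`:
`T x₀` is a single point `y₀`, and `ξ = y₀ + A(x - x₀) + o(|x - x₀|)` as `x → x₀`, uniformly
in `ξ ∈ T x`. -/
def HasDerivativeAt {n : ℕ} (T : E n → Set (E n)) (A : Matrix (Fin n) (Fin n) ℝ)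
    (x₀ : E n) : Prop :=
  ∃ y₀ : E n, T x₀ = {y₀} ∧ ∀ η : ℝ, 0 < η → ∀ᶠ x in 𝓝 x₀, ∀ ξ ∈ T x,
    ‖ξ - y₀ - Matrix.toEuclideanCLM (𝕜 := ℝ) A (x - x₀)‖ ≤ η * ‖x - x₀‖

end HMonotone

namespace HMonotone

/-! ### Hessian of the cost and the cone condition -/

section Cost

variable {n : ℕ} {p : ℝ} {h : E n → ℝ}

/-! Differencing `h` in the directions `y - x` and `ξ - ζ` turns the monotonicity inequality into a
statement about the Hessian: the form `D²h(v)(ξ - ζ, y - x)` cannot be positive for all `v ≠ 0`. By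
homogeneity, `D²h(v)` is a positive multiple of a Hessian on the sphere, so its degeneracy at the
origin is harmless, and ellipticity yields a scale-invariant cone condition (`IsCost.exists_cone`):
`y - x` stays away from positive multiples of `ξ - ζ`.

If some `ξ ∈ T x` misses the affine map by a vector `d` with `|d| > ηR`, look at `y` near `x + δR
d/|d|`. Were `f y` close to the affine map, `ξ - f y` would be nearly `d`, hence nearly parallel to
`y - x`, which the cone forbids. So `f` deviates by a multiple of `ηR` on a ball filling a fixed
fraction of `B_{2R}(x₀)` (`deviation_le`), contradicting smallness of the mean. -/

lemma IsCost.differentiable (hh : IsCost p h) : Differentiable ℝ h :=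
  hh.contDiff.differentiable (by norm_num)

lemma IsCost.contDiff_fderiv (hh : IsCost p h) : ContDiff ℝ 1 (fderiv ℝ h) :=
  hh.contDiff.fderiv_right (by norm_num)

lemma IsCost.differentiable_fderiv (hh : IsCost p h) : Differentiable ℝ (fderiv ℝ h) :=
  hh.contDiff_fderiv.differentiable (by norm_num)

lemma IsCost.continuous_hessian (hh : IsCost p h) : Continuous (fderiv ℝ (fderiv ℝ h)) :=
  hh.contDiff_fderiv.continuous_fderiv (by norm_num)

lemma IsCost.fderiv_smul (hh : IsCost p h) {t : ℝ} (ht : 0 < t) (x : E n) :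
    t • fderiv ℝ h (t • x) = t ^ p • fderiv ℝ h x := by
  have h1 : (fun x => h (t • x)) = fun x => t ^ p * h x :=
    funext fun x => hh.homogeneous t x ht
  rw [← fderiv_comp_smul, h1, fderiv_const_mul (hh.differentiable x)]

/-- The Hessian of a cost is positively homogeneous of degree `p - 2`. -/
lemma IsCost.hessian_smul (hh : IsCost p h) {t : ℝ} (ht : 0 < t) (x : E n) :
    (t * t) • fderiv ℝ (fderiv ℝ h) (t • x) = t ^ p • fderiv ℝ (fderiv ℝ h) x := by
  have h1 : (fun x => t • fderiv ℝ h (t • x)) = fun x => t ^ p • fderiv ℝ h x :=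
    funext fun x => hh.fderiv_smul ht x
  have h2 := congrArg (fun g => fderiv ℝ g x) h1
  have h3 : Differentiable ℝ fun x => fderiv ℝ h (t • x) :=
    hh.differentiable_fderiv.comp (differentiable_id.const_smul t)
  rw [fderiv_fun_const_smul (h3 x), fderiv_fun_const_smul (hh.differentiable_fderiv x),
    fderiv_comp_smul, smul_smul] at h2
  exact h2

/-- The Hessian at `v ≠ 0` is, up to a positive factor, uniformly elliptic and bounded. -/
lemma IsCost.hessian_bounds (hh : IsCost p h) :
    ∃ l C : ℝ, 0 < l ∧ 0 < C ∧ ∀ v : E n, v ≠ 0 → ∃ c : ℝ, 0 < c ∧ ∀ a b : E n,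
      c * (l * ‖a‖ ^ 2) ≤ fderiv ℝ (fderiv ℝ h) v a a ∧
      -(c * (C * ‖a‖ * ‖b‖)) ≤ fderiv ℝ (fderiv ℝ h) v a b := by
  obtain ⟨l, L, hl, -, hlL⟩ := hh.elliptic
  -- Ellipticity only controls the diagonal of the form; compactness of the sphere bounds the mixed
  -- terms.
  obtain ⟨C, hC⟩ := (isCompact_sphere (0 : E n) 1).exists_bound_of_continuousOn
    (f := fderiv ℝ (fderiv ℝ h)) hh.continuous_hessian.continuousOn
  refine ⟨l, max C 1, hl, by positivity, fun v hv => ?_⟩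
  have hv' : 0 < ‖v‖ := norm_pos_iff.2 hv
  set e : E n := ‖v‖⁻¹ • v with he
  have hne : ‖e‖ = 1 := by rw [he, norm_smul, norm_inv, norm_norm, inv_mul_cancel₀ hv'.ne']
  have hve : ‖v‖ • e = v := by rw [he, smul_smul, mul_inv_cancel₀ hv'.ne', one_smul]
  have key := hh.hessian_smul hv' e
  rw [hve] at key
  have hH : fderiv ℝ (fderiv ℝ h) v
      = ((‖v‖ * ‖v‖)⁻¹ * ‖v‖ ^ p) • fderiv ℝ (fderiv ℝ h) e := by
    rw [mul_smul, ← key, smul_smul, inv_mul_cancel₀ (by positivity), one_smul]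
  have hc : 0 < (‖v‖ * ‖v‖)⁻¹ * ‖v‖ ^ p := by positivity
  refine ⟨_, hc, fun a b => ?_⟩
  rw [hH]
  simp only [_root_.smul_apply, smul_eq_mul]
  refine ⟨mul_le_mul_of_nonneg_left (hlL e a hne).1 hc.le, ?_⟩
  rw [← mul_neg]
  refine mul_le_mul_of_nonneg_left ?_ hc.le
  have h1 := (fderiv ℝ (fderiv ℝ h) e).le_opNorm₂ a b
  have h2 : ‖fderiv ℝ (fderiv ℝ h) e‖ ≤ max C 1 :=
    (hC e (by simpa using hne)).trans (le_max_left _ _)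
  have h3 : ‖fderiv ℝ (fderiv ℝ h) e‖ * ‖a‖ * ‖b‖ ≤ max C 1 * ‖a‖ * ‖b‖ := by gcongr
  have h4 := neg_abs_le (fderiv ℝ (fderiv ℝ h) e a b)
  rw [Real.norm_eq_abs] at h1
  linarith

/-- Four points violate the cyclical inequality strictly if the Hessian, applied to the two
differences, is positive away from the origin. -/
lemma IsCost.lt_of_hessian_pos (hh : IsCost p h) {x y ξ ζ : E n}
    (hpos : ∀ v : E n, v ≠ 0 → 0 < fderiv ℝ (fderiv ℝ h) v (ξ - ζ) (y - x)) (hne : ξ ≠ ζ) :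
    h (x - ζ) + h (y - ξ) < h (x - ξ) + h (y - ζ) := by
  have hD : ξ - ζ ≠ 0 := sub_ne_zero.2 hne
  -- The points given by the mean value theorem may hit the origin, where only the weak inequality
  -- survives, by continuity.
  have hnonneg : ∀ v : E n, 0 ≤ fderiv ℝ (fderiv ℝ h) v (ξ - ζ) (y - x) := by
    have : Nontrivial (E n) := ⟨⟨_, _, hne⟩⟩
    have hcl : IsClosed {v : E n | 0 ≤ fderiv ℝ (fderiv ℝ h) v (ξ - ζ) (y - x)} :=
      isClosed_le continuous_const
        ((hh.continuous_hessian.clm_apply continuous_const).clm_apply continuous_const)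
    have hsub : ({0}ᶜ : Set (E n)) ⊆ {v : E n | 0 ≤ fderiv ℝ (fderiv ℝ h) v (ξ - ζ) (y - x)} :=
      fun v hv => (hpos v hv).le
    intro v
    exact hcl.closure_subset_iff.2 hsub (dense_compl_singleton (0 : E n) v)
  by_contra! hle
  -- first differences in the direction `y - x`
  have hF : ∀ t : ℝ, HasDerivAt
      (fun t : ℝ => h (x + t • (y - x) - ζ) - h (x + t • (y - x) - ξ))
      (fderiv ℝ h (x + t • (y - x) - ζ) (y - x) - fderiv ℝ h (x + t • (y - x) - ξ) (y - x)) t := by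
    intro t
    have aux : ∀ z : E n, HasDerivAt (fun t : ℝ => x + t • (y - x) - z) (y - x) t := fun z => by
      simpa using (((hasDerivAt_id t).smul_const (y - x)).const_add x).sub_const z
    exact ((hh.differentiable _).hasFDerivAt.comp_hasDerivAt t (aux ζ)).sub
      ((hh.differentiable _).hasFDerivAt.comp_hasDerivAt t (aux ξ))
  obtain ⟨t, -, ht⟩ := exists_hasDerivAt_eq_slope _ _ (zero_lt_one (α := ℝ))
    (fun t _ => (hF t).continuousAt.continuousWithinAt) (fun t _ => hF t)
  simp only [one_smul, zero_smul, add_zero, add_sub_cancel, sub_zero, div_one] at ht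
  set q := x + t • (y - x) with hq
  -- second differences in the direction `ξ - ζ`
  have hG : ∀ s : ℝ, HasDerivAt (fun s : ℝ => fderiv ℝ h (q - ξ + s • (ξ - ζ)) (y - x))
      (fderiv ℝ (fderiv ℝ h) (q - ξ + s • (ξ - ζ)) (ξ - ζ) (y - x)) s := by
    intro s
    have aux : HasDerivAt (fun s : ℝ => q - ξ + s • (ξ - ζ)) (ξ - ζ) s := by
      simpa using ((hasDerivAt_id s).smul_const (ξ - ζ)).const_add (q - ξ)
    have h1 := (hh.differentiable_fderiv _).hasFDerivAt.comp_hasDerivAt s aux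
    simpa using h1.clm_apply (hasDerivAt_const s (y - x))
  -- Splitting at `1 / 2` produces two distinct intermediate points, so at least one is nonzero and
  -- contributes strictly.
  obtain ⟨s₁, hs₁, h₁⟩ := exists_hasDerivAt_eq_slope _ _ (show (0 : ℝ) < 1 / 2 by norm_num)
    (fun t _ => (hG t).continuousAt.continuousWithinAt) (fun t _ => hG t)
  obtain ⟨s₂, hs₂, h₂⟩ := exists_hasDerivAt_eq_slope _ _ (show (1 / 2 : ℝ) < 1 by norm_num)
    (fun t _ => (hG t).continuousAt.continuousWithinAt) (fun t _ => hG t)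
  have e1 : q - ξ + (1 : ℝ) • (ξ - ζ) = q - ζ := by rw [one_smul]; abel
  rw [e1] at h₂
  rw [zero_smul, add_zero] at h₁
  have n₁ := hnonneg (q - ξ + s₁ • (ξ - ζ))
  have n₂ := hnonneg (q - ξ + s₂ • (ξ - ζ))
  have hv : q - ξ + s₁ • (ξ - ζ) ≠ 0 ∨ q - ξ + s₂ • (ξ - ζ) ≠ 0 := by
    by_contra! hcon
    have h3 : s₁ • (ξ - ζ) = s₂ • (ξ - ζ) :=
      add_left_cancel (hcon.1.trans hcon.2.symm)
    exact (hs₁.2.trans hs₂.1).ne (smul_left_injective ℝ hD h3)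
  have hsum : 0 < fderiv ℝ (fderiv ℝ h) (q - ξ + s₁ • (ξ - ζ)) (ξ - ζ) (y - x)
      + fderiv ℝ (fderiv ℝ h) (q - ξ + s₂ • (ξ - ζ)) (ξ - ζ) (y - x) := by
    rcases hv with hv | hv
    · linarith [hpos _ hv]
    · linarith [hpos _ hv]
  rw [h₁, h₂, sub_zero, sub_half, ← add_div] at hsum
  have hpos' := (div_pos_iff_of_pos_right (by norm_num)).1 hsum
  linarith

/-- Two pairs satisfying the cyclical inequality obey a cone condition: `y - x` cannot be close
to a positive multiple of `ξ - ζ`. -/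
lemma IsCost.exists_cone (hh : IsCost p h) :
    ∃ κ : ℝ, 0 < κ ∧ κ ≤ 1 ∧ ∀ x y ξ ζ : E n,
      h (x - ξ) + h (y - ζ) ≤ h (x - ζ) + h (y - ξ) → ∀ σ : ℝ, 0 < σ →
        κ * (σ * ‖ξ - ζ‖) ≤ ‖(y - x) - σ • (ξ - ζ)‖ := by
  obtain ⟨l, C, hl, hC, hb⟩ := hh.hessian_bounds
  -- With `l / C`, the elliptic term in `σ • (ξ - ζ)` beats the mixed term in the remainder `r`.
  refine ⟨min 1 (l / C), by positivity, min_le_left _ _, fun x y ξ ζ hle σ hσ => ?_⟩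
  by_contra! hlt
  set r := (y - x) - σ • (ξ - ζ) with hr
  have hr' : y - x = σ • (ξ - ζ) + r := by rw [hr]; abel
  have hD : 0 < ‖ξ - ζ‖ := by
    by_contra! h0
    have h0' : ‖ξ - ζ‖ = 0 := le_antisymm h0 (norm_nonneg _)
    rw [h0', mul_zero, mul_zero] at hlt
    exact absurd hlt (norm_nonneg r).not_gt
  refine absurd hle (hh.lt_of_hessian_pos (fun v hv => ?_)
    (sub_ne_zero.1 (norm_pos_iff.1 hD))).not_ge
  obtain ⟨c, hc, hcb⟩ := hb v hv
  have h1 := (hcb (ξ - ζ) r).1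
  have h2 := (hcb (ξ - ζ) r).2
  have h3 : C * ‖r‖ < l * (σ * ‖ξ - ζ‖) := by
    have h4 : ‖r‖ < l / C * (σ * ‖ξ - ζ‖) :=
      hlt.trans_le (mul_le_mul_of_nonneg_right (min_le_right _ _) (by positivity))
    calc C * ‖r‖ < C * (l / C * (σ * ‖ξ - ζ‖)) := by gcongr
      _ = l * (σ * ‖ξ - ζ‖) := by field_simp
  rw [hr', map_add, map_smul, smul_eq_mul]
  have h5 : c * (C * ‖ξ - ζ‖ * ‖r‖) < σ * (c * (l * ‖ξ - ζ‖ ^ 2)) := by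
    have := mul_lt_mul_of_pos_left h3 (mul_pos hc hD)
    nlinarith
  have h6 := mul_le_mul_of_nonneg_left h1 hσ.le
  linarith

end Cost

section Affine

variable {n : ℕ} (A : Matrix (Fin n) (Fin n) ℝ) (b : E n)

lemma affine_sub_affine (x y : E n) :
    affine A b x - affine A b y = Matrix.toEuclideanCLM (𝕜 := ℝ) A (x - y) := by
  simp [affine, map_sub]

lemma continuous_affine : Continuous (affine A b) :=
  (Matrix.toEuclideanCLM (𝕜 := ℝ) A).continuous.add continuous_const

end Affine

/-! ### Propagation of a deviation to a ball -/

/-- If `ξ ∈ T x` deviates from the affine map by more than `d`, then so does (up to a factor)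
every value `ζ ∈ T y` for `y` in a small ball near `x` in the direction of the deviation. -/
lemma deviation_le {n : ℕ} {κ s : ℝ} (hκ : 0 < κ) (hκ1 : κ ≤ 1) (hs : 0 < s)
    {A : Matrix (Fin n) (Fin n) ℝ} {b x y ξ ζ : E n}
    (hd : ξ - affine A b x ≠ 0)
    (hcone : ∀ σ : ℝ, 0 < σ → κ * (σ * ‖ξ - ζ‖) ≤ ‖(y - x) - σ • (ξ - ζ)‖)
    (hy : y ∈ ball (x + (s / ‖ξ - affine A b x‖) • (ξ - affine A b x)) (κ / 4 * s)) :
    3 / 8 * κ * ‖ξ - affine A b x‖ ≤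
      ‖Matrix.toEuclideanCLM (𝕜 := ℝ) A‖ * (2 * s) + ‖ζ - affine A b y‖ := by
  set d := ξ - affine A b x with hdef
  set k := Matrix.toEuclideanCLM (𝕜 := ℝ) A (x - y) - (ζ - affine A b y) with hk
  have hd0 : 0 < ‖d‖ := norm_pos_iff.2 hd
  set σ := s / ‖d‖ with hσ
  have hσ0 : 0 < σ := by positivity
  have hσd : σ * ‖d‖ = s := by rw [hσ]; field_simp
  have hD : ξ - ζ = d + k := by
    rw [hk, ← affine_sub_affine A b, hdef]; abel
  have hyn : ‖y - x - σ • d‖ < κ / 4 * s := by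
    rw [mem_ball_iff_norm] at hy
    rwa [sub_sub]
  have h1 := hcone σ hσ0
  have h2 : ‖(y - x) - σ • (ξ - ζ)‖ ≤ κ / 4 * s + σ * ‖k‖ := by
    have e : (y - x) - σ • (ξ - ζ) = (y - x - σ • d) - σ • k := by
      rw [hD, smul_add]; abel
    rw [e]
    refine (norm_sub_le _ _).trans ?_
    rw [norm_smul, Real.norm_of_nonneg hσ0.le]
    gcongr
  have h3 : ‖d‖ - ‖k‖ ≤ ‖ξ - ζ‖ := by
    rw [hD]
    have := norm_sub_le (d + k) k
    rw [add_sub_cancel_right] at this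
    linarith
  have h4 : κ * (‖d‖ - ‖k‖) ≤ κ / 4 * ‖d‖ + ‖k‖ := by
    refine le_of_mul_le_mul_left ?_ hσ0
    calc σ * (κ * (‖d‖ - ‖k‖)) = κ * (σ * (‖d‖ - ‖k‖)) := by ring
      _ ≤ κ * (σ * ‖ξ - ζ‖) := by gcongr
      _ ≤ κ / 4 * s + σ * ‖k‖ := h1.trans h2
      _ = σ * (κ / 4 * ‖d‖ + ‖k‖) := by rw [← hσd]; ring
  have h5 : ‖x - y‖ ≤ 2 * s := by
    rw [norm_sub_rev]
    have e : y - x = (y - x - σ • d) + σ • d := by abel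
    rw [e]
    refine (norm_add_le _ _).trans ?_
    rw [norm_smul, Real.norm_of_nonneg hσ0.le, hσd]
    nlinarith
  have h6 : ‖k‖ ≤ ‖Matrix.toEuclideanCLM (𝕜 := ℝ) A‖ * (2 * s) + ‖ζ - affine A b y‖ := by
    refine (norm_sub_le _ _).trans ?_
    gcongr
    exact ((Matrix.toEuclideanCLM (𝕜 := ℝ) A).le_opNorm _).trans (by gcongr)
  -- `h4` reads `3/4 κ‖d‖ ≤ (1 + κ)‖k‖`, and `1 + κ ≤ 2` gives the factor `3/8`.
  nlinarith [norm_nonneg k]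

/-! ### From the mean to the supremum -/

/-- Markov-type lower bound: if `g ≥ m` a.e. on a subball, then the mean of `g` is bounded below. -/
lemma mul_le_setAverage_of_le_on_ball {n : ℕ} {g : E n → ℝ} {x z : E n} {r R m : ℝ}
    (hr : 0 < r) (hR : 0 < R) (hsub : ball z r ⊆ ball x R) (hg0 : ∀ y, 0 ≤ g y)
    (hg : IntegrableOn g (ball x R)) (hm : ∀ᵐ y ∂(volume.restrict (ball z r)), m ≤ g y) :
    (r / R) ^ n * m ≤ ⨍ y in ball x R, g y := by
  have hvol : ∀ (c : E n) (ρ : ℝ), 0 < ρ →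
      volume.real (ball c ρ) = ρ ^ n * volume.real (ball (0 : E n) 1) := by
    intro c ρ hρ
    rw [Measure.real, Measure.addHaar_ball_of_pos volume c hρ, ENNReal.toReal_mul,
      ENNReal.toReal_ofReal (by positivity), finrank_euclideanSpace, Fintype.card_fin, Measure.real]
  have hω : 0 < volume.real (ball (0 : E n) 1) :=
    ENNReal.toReal_pos (measure_ball_pos volume _ one_pos).ne' measure_ball_lt_top.ne
  have h1 : volume.real (ball z r) * m ≤ ∫ y in ball z r, g y := by
    have h2 : ∫ _ in ball z r, m ≤ ∫ y in ball z r, g y := by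
      refine integral_mono_ae ?_ (hg.mono_set hsub) hm
      exact integrableOn_const measure_ball_lt_top.ne
    rwa [setIntegral_const, smul_eq_mul] at h2
  have h3 : ∫ y in ball z r, g y ≤ ∫ y in ball x R, g y :=
    setIntegral_mono_set hg (Eventually.of_forall hg0) hsub.eventuallyLE
  rw [setAverage_eq, smul_eq_mul, hvol x R hR]
  rw [hvol z r hr] at h1
  rw [div_pow, inv_mul_eq_div, le_div_iff₀ (by positivity)]
  calc r ^ n / R ^ n * m * (R ^ n * volume.real (ball (0 : E n) 1))
      = r ^ n * volume.real (ball (0 : E n) 1) * m := by field_simp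
    _ ≤ _ := h1.trans h3

/-- Needed because the Bochner average of a non-integrable function is `0`, so smallness of the mean
would say nothing. -/
lemma RepresentsInLp.integrableOn_deviation {n : ℕ} {T : E n → Set (E n)} {f : E n → E n}
    {q ε R : ℝ} {x₀ : E n} (hf : RepresentsInLp T f q (ball x₀ ε)) (hq : 0 < q) (hR : R ≤ ε)
    (A : Matrix (Fin n) (Fin n) ℝ) (b : E n) :
    IntegrableOn (fun y => ‖f y - affine A b y‖ ^ q) (ball x₀ R) := by
  have h1 : MemLp f (ENNReal.ofReal q) (volume.restrict (ball x₀ R)) :=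
    hf.1.mono_measure (Measure.restrict_mono (ball_subset_ball hR) le_rfl)
  obtain ⟨C, hC⟩ := (isCompact_closedBall x₀ R).exists_bound_of_continuousOn
    (continuous_affine A b).continuousOn
  have : IsFiniteMeasure (volume.restrict (ball x₀ R)) :=
    isFiniteMeasure_restrict.2 measure_ball_lt_top.ne
  have h2 : MemLp (affine A b) (ENNReal.ofReal q) (volume.restrict (ball x₀ R)) := by
    refine MemLp.of_bound (continuous_affine A b).aestronglyMeasurable C ?_
    filter_upwards [ae_restrict_mem measurableSet_ball] with y hy
    exact hC y (ball_subset_closedBall hy)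
  have h3 := (h1.sub h2).integrable_norm_rpow (by simpa using hq) ENNReal.ofReal_ne_top
  rwa [ENNReal.toReal_ofReal hq.le] at h3

/-- Differentiability in mean of an `h`-monotone map self-improves to differentiability in sup. -/
theorem approxInSup_of_approxInMean {n : ℕ} {p : ℝ} (hp : 1 < p) {h : E n → ℝ} (hh : IsCost p h)
    {T : E n → Set (E n)} (hT : IsHMonotone h T) {x₀ : E n} {ε : ℝ} (hε : 0 < ε)
    {f : E n → E n} (hf : RepresentsInLp T f (p - 1) (ball x₀ ε))
    {A : Matrix (Fin n) (Fin n) ℝ} {b : E n} (happ : ApproxInMean f (p - 1) x₀ A b) :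
    ApproxInSup T x₀ A b := by
  intro η hη
  obtain ⟨κ, hκ, hκ1, hcone⟩ := hh.exists_cone
  have hq : 0 < p - 1 := by linarith
  set N := ‖Matrix.toEuclideanCLM (𝕜 := ℝ) A‖ with hN
  have hN0 : 0 ≤ N := norm_nonneg _
  -- `δ ≤ 1/2` keeps the small ball inside `B_{2R}(x₀)`; the bound on `N` leaves `3/8 - 1/8 = 1/4`
  -- of `κη` as deviation.
  obtain ⟨δ, hδ, hδ1, hδN⟩ : ∃ δ : ℝ, 0 < δ ∧ δ ≤ 1 / 2 ∧ N * (2 * δ) ≤ κ * η / 8 := by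
    refine ⟨min (1 / 2) (κ * η / (16 * (N + 1))), by positivity, min_le_left _ _, ?_⟩
    calc N * (2 * min (1 / 2) (κ * η / (16 * (N + 1))))
        ≤ (N + 1) * (2 * (κ * η / (16 * (N + 1)))) := by
          gcongr
          · linarith
          · exact min_le_right _ _
      _ = κ * η / 8 := by field_simp; norm_num
  -- Volume fraction of a ball of radius `κδR/4` in one of radius `2R`.
  set θ := (κ / 4 * δ / 2) ^ n with hθ
  have hθ0 : 0 < θ := by positivity
  set c₀ := θ ^ (1 / (p - 1)) * (κ * η / 4) with hc₀
  have hc₀0 : 0 < c₀ := by positivity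
  -- At radius `2R` this allows a mean of at most `c₀R/2`, while a deviation forces at least `c₀R`.
  have hsmall := happ.def (show 0 < c₀ / 4 by positivity)
  have htwo : Tendsto (fun R : ℝ => 2 * R) (𝓝[>] 0) (𝓝[>] 0) := by
    refine tendsto_nhdsWithin_iff.2 ⟨?_, ?_⟩
    · have : Tendsto (fun R : ℝ => 2 * R) (𝓝 0) (𝓝 0) := by
        simpa using (continuous_const_mul (2 : ℝ)).tendsto 0
      exact this.mono_left nhdsWithin_le_nhds
    · filter_upwards [self_mem_nhdsWithin] with R (hR : 0 < R)
      simpa using hR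
  filter_upwards [htwo.eventually hsmall, self_mem_nhdsWithin,
    Ioo_mem_nhdsGT (show 0 < ε / 2 by positivity)] with R hR2 (hR : 0 < R) hRε x hx ξ hξ
  by_contra! hlt
  have hd0 : 0 < ‖ξ - affine A b x‖ := lt_trans (by positivity) hlt
  have hs : 0 < δ * R := by positivity
  have hRε' : 2 * R ≤ ε := by linarith [hRε.2]
  set z := x + (δ * R / ‖ξ - affine A b x‖) • (ξ - affine A b x) with hz
  have hsub : ball z (κ / 4 * (δ * R)) ⊆ ball x₀ (2 * R) := by
    refine ball_subset_ball' ?_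
    have h1 : dist z x = δ * R := by
      rw [hz, dist_self_add_left, norm_smul, Real.norm_of_nonneg (by positivity)]
      field_simp
    have h2 := dist_triangle z x x₀
    have h3 : dist x x₀ < R := hx
    have h4 : κ / 4 * (δ * R) ≤ 1 / 4 * (1 / 2 * R) := by gcongr
    have h5 : δ * R ≤ 1 / 2 * R := by gcongr
    linarith
  have hae : ∀ᵐ y ∂(volume.restrict (ball z (κ / 4 * (δ * R)))),
      (κ * η / 4 * R) ^ (p - 1) ≤ ‖f y - affine A b y‖ ^ (p - 1) := by
    have h1 := ae_restrict_of_ae_restrict_of_subset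
      (hsub.trans (ball_subset_ball hRε')) hf.2
    filter_upwards [h1, ae_restrict_mem measurableSet_ball] with y hfy hy
    have h2 := deviation_le hκ hκ1 hs (norm_pos_iff.1 hd0)
      (hcone x y ξ (f y) (hT x y ξ (f y) hξ hfy)) hy
    have h3 : 3 / 8 * κ * (η * R) ≤ 3 / 8 * κ * ‖ξ - affine A b x‖ := by gcongr
    have h4 : N * (2 * δ) * R ≤ κ * η / 8 * R := by gcongr
    refine Real.rpow_le_rpow (by positivity) ?_ hq.le
    linarith
  have havg := mul_le_setAverage_of_le_on_ball (x := x₀) (R := 2 * R) (by positivity)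
    (by positivity) hsub (fun y => by positivity)
    (hf.integrableOn_deviation hq hRε' A b) hae
  have hratio : κ / 4 * (δ * R) / (2 * R) = κ / 4 * δ / 2 := by field_simp
  rw [hratio, ← hθ] at havg
  have hroot := Real.rpow_le_rpow (by positivity) havg (show 0 ≤ 1 / (p - 1) by positivity)
  rw [Real.mul_rpow (by positivity) (by positivity), ← Real.rpow_mul (by positivity),
    mul_one_div_cancel hq.ne', Real.rpow_one] at hroot
  have hfin := (hroot.trans (le_abs_self _)).trans hR2
  rw [Real.norm_of_nonneg (show 0 ≤ 2 * R by positivity)] at hfin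
  have h1 : c₀ * R ≤ c₀ / 4 * (2 * R) := by
    refine le_trans (le_of_eq ?_) hfin
    rw [hc₀]; ring
  nlinarith [mul_pos hc₀0 hR]

/-- Approximation in sup by an affine map is ordinary differentiability at points of the domain. -/
theorem ApproxInSup.hasDerivativeAt {n : ℕ} {T : E n → Set (E n)} {x₀ : E n}
    {A : Matrix (Fin n) (Fin n) ℝ} {b : E n} (hsup : ApproxInSup T x₀ A b) (hx₀ : x₀ ∈ dom T) :
    HasDerivativeAt T A x₀ := by
  have huniq : ∀ ξ ∈ T x₀, ξ = affine A b x₀ := by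
    intro ξ hξ
    have hle : ∀ᶠ R in 𝓝[>] (0 : ℝ), ‖ξ - affine A b x₀‖ ≤ 1 * R := by
      filter_upwards [hsup 1 one_pos, self_mem_nhdsWithin] with R hR (hR0 : 0 < R)
      exact hR x₀ (mem_ball_self hR0) ξ hξ
    have hlim : Tendsto (fun R : ℝ => 1 * R) (𝓝[>] 0) (𝓝 0) := by
      simpa using ((continuous_const_mul (1 : ℝ)).tendsto 0).mono_left nhdsWithin_le_nhds
    exact sub_eq_zero.1 (norm_le_zero_iff.1 (ge_of_tendsto hlim hle))
  refine ⟨affine A b x₀, ?_, fun η hη => ?_⟩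
  · obtain ⟨ξ, hξ⟩ := hx₀
    exact Set.eq_singleton_iff_unique_mem.2 ⟨huniq ξ hξ ▸ hξ, huniq⟩
  -- The balls are open, so `x` is caught with radius `2‖x - x₀‖`; hence `η / 2`.
  obtain ⟨ρ, hρ, hρT⟩ := mem_nhdsGT_iff_exists_Ioo_subset.1 (hsup (η / 2) (by positivity))
  filter_upwards [ball_mem_nhds x₀ (show 0 < ρ / 2 from half_pos hρ)] with x hx ξ hξ
  rcases eq_or_ne x x₀ with rfl | hne
  · simp [huniq ξ hξ]
  have hpos : 0 < ‖x - x₀‖ := norm_pos_iff.2 (sub_ne_zero.2 hne)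
  rw [mem_ball_iff_norm] at hx
  have hmem := hρT (show 2 * ‖x - x₀‖ ∈ Set.Ioo 0 ρ from ⟨by positivity, by linarith⟩)
  have h1 := hmem x (by rw [mem_ball_iff_norm]; linarith) ξ hξ
  rw [← affine_sub_affine A b, sub_sub, add_sub_cancel]
  linarith

end HMonotone

theorem mainTheorem2 (n : ℕ) (p : ℝ) (hp : 2 ≤ p)
    (h : HMonotone.E n → ℝ) (hh : HMonotone.IsCost p h)
    (T : HMonotone.E n → Set (HMonotone.E n)) (hT : HMonotone.IsHMonotone h T)
    (x₀ : HMonotone.E n) (ε : ℝ) (hε : 0 < ε)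
    (f : HMonotone.E n → HMonotone.E n)
    (hf : HMonotone.RepresentsInLp T f (p - 1) (ball x₀ ε))
    (A : Matrix (Fin n) (Fin n) ℝ) (b : HMonotone.E n)
    (happ : HMonotone.ApproxInMean f (p - 1) x₀ A b) :
    HMonotone.ApproxInSup T x₀ A b ∧
      (x₀ ∈ HMonotone.dom T → HMonotone.HasDerivativeAt T A x₀) := by
  have hsup := HMonotone.approxInSup_of_approxInMean (by linarith) hh hT hε hf happ
  exact ⟨hsup, hsup.hasDerivativeAt⟩
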